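/- Theorem. For a permutation $\sigma\in S_m$, written $\sigma=\sigma_1\sigma_2\cdots\sigma_m$, a permutation $\pi\in S_n$ contains $\sigma$ as a consecutive pattern if some $m$ consecutive entries $\pi_i\pi_{i+1}\cdots\pi_{i+m-1}$ ($1\le i\le n-m+1$) are in the same relative order as $\sigma_1\cdots\sigma_m$; otherwise $\pi$ avoids $\sigma$. Let $\alpha_n(\sigma)$ be the number of permutations in $S_n$ that avoid $\sigma$ as a consecutive pattern, and let $\rho_\sigma=\lim_{n\to\infty}\left(\alpha_n(\sigma)/n!\right)^{1/n}$ be the growth constant of $\sigma$. Call $\sigma$ non-overlapping if $i=m-1$ is the only index $1\le i<m$ for which $\sigma_{i+1}\sigma_{i+2}\cdots\sigma_m$ and $\sigma_1\sigma_2\cdots\sigma_{m-i}$ are in the same relative order. Let $m\ge 3$ and let $\sigma\in S_m$ be non-overlapping. Then there exists $n_0$ such that $$\alpha_n(\sigma)<\alpha_n(12\cdots m)\qquad\text{for all } n\ge n_0.$$ Moreover, the limits defining $\rho_\sigma$ and $\rho_{12\cdots m}$ exist and $\rho_\sigma<\rho_{12\cdots m}$. -/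

import Mathlib

open Filter Topology
open scoped Nat

namespace ConsecutivePattern

/-- Two words of the same length over linearly ordered alphabets are in the same relative order;
for words with distinct entries this says that their reductions coincide. -/
def SameOrder {α β : Type*} [LT α] [LT β] {k : ℕ} (f : Fin k → α) (g : Fin k → β) : Prop :=
  ∀ a b : Fin k, f a < f b ↔ g a < g b

/-- A permutation in `S_n` is an `Equiv.Perm (Fin n)`, in one-line notation `π 0, π 1, …, π (n-1)`.
`OccursAt σ π i`: the entries `π i, …, π (i + m - 1)` exist and form an occurrence of `σ`. -/
def OccursAt {m n : ℕ} (σ : Equiv.Perm (Fin m)) (π : Equiv.Perm (Fin n)) (i : ℕ) : Prop :=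
  ∃ h : i + m ≤ n, SameOrder (fun j : Fin m => π ⟨i + j, by omega⟩) (fun j : Fin m => σ j)

/-- `π` avoids `σ` as a consecutive pattern. -/
def Avoids {m n : ℕ} (σ : Equiv.Perm (Fin m)) (π : Equiv.Perm (Fin n)) : Prop :=
  ∀ i : ℕ, ¬ OccursAt σ π i

/-- `alpha σ n` is the number of permutations in `S_n` that avoid `σ` as a consecutive pattern. -/
noncomputable def alpha {m : ℕ} (σ : Equiv.Perm (Fin m)) (n : ℕ) : ℕ :=
  Nat.card {π : Equiv.Perm (Fin n) // Avoids σ π}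

/-- The set of overlaps of `σ`: the `i` with `1 ≤ i < m` such that the last `m - i` entries of `σ`
are in the same relative order as the first `m - i` entries. -/
def overlapSet {m : ℕ} (σ : Equiv.Perm (Fin m)) : Set ℕ :=
  {i | 1 ≤ i ∧ i < m ∧
    SameOrder (fun j : Fin (m - i) => σ ⟨i + j, by omega⟩)
      (fun j : Fin (m - i) => σ ⟨j, by omega⟩)}

/-- `σ` is non-overlapping: `m - 1` is its only overlap, so two occurrences of `σ` in a permutation
overlap in at most one position. -/
def NonOverlapping {m : ℕ} (σ : Equiv.Perm (Fin m)) : Prop :=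
  overlapSet σ = {m - 1}

/-- The monotone pattern `12⋯m`. -/
def monotonePattern (m : ℕ) : Equiv.Perm (Fin m) := Equiv.refl (Fin m)

/-- `ρ` is the growth constant of `σ`: the limit of `(alpha σ n / n!)^(1/n)` exists and is `ρ`. -/
def IsGrowthConstant {m : ℕ} (σ : Equiv.Perm (Fin m)) (ρ : ℝ) : Prop :=
  Tendsto (fun n : ℕ => ((alpha σ n : ℝ) / (n ! : ℝ)) ^ ((1 : ℝ) / (n : ℝ))) atTop (𝓝 ρ)

end ConsecutivePattern

namespace ConsecutivePattern

/-! ### Relative orders and standardization of words -/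

section Standardization

/-! Let a_n = α_n/n! be the avoidance probability and A its generating function. A truncated cluster
expansion gives one-sided recurrences for a_n, hence, for z ≥ 0 where the series converge,
T(z)A_σ(z) ≤ 1 and Q(z)A_mon(z) ≥ 1 with T = `clusterPoly σ` and Q = `monotonePoly m`
(`clusterPoly_mul_le_one`, `one_le_monotonePoly_mul`). Both polynomials start with 1 - z + z^m/m!.
The next term of Q is -z^(m+1)/(m+1)!, since increasing runs can be shifted by one; that of T is
only -p z^(2m-1), with p = `clusterProb σ` small. So T > Q on (0, c] for some c with Q(c) ≤ 0
(`exists_comparison_point`).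

At the first zero z ≤ c of Q the monotone series cannot have radius of convergence beyond z, so
zρ_mon ≥ 1. On [0, z] the polynomial T is positive, which bounds A_σ and forces zρ_σ < 1
(`mul_growth_lt_one`). Hence ρ_σ < ρ_mon, and comparing n-th roots gives the inequality for large n.
The limits exist by submultiplicativity of a_n. -/

theorem SameOrder.symm {α β : Type*} [LT α] [LT β] {k : ℕ} {f : Fin k → α} {g : Fin k → β}
    (h : SameOrder f g) : SameOrder g f := fun a b => (h a b).symm

theorem SameOrder.trans {α β γ : Type*} [LT α] [LT β] [LT γ] {k : ℕ} {f : Fin k → α}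
    {g : Fin k → β} {e : Fin k → γ} (h : SameOrder f g) (h' : SameOrder g e) : SameOrder f e :=
  fun a b => (h a b).trans (h' a b)

theorem SameOrder.comp {α β : Type*} [LT α] [LT β] {k l : ℕ} {f : Fin k → α} {g : Fin k → β}
    (h : SameOrder f g) (e : Fin l → Fin k) : SameOrder (f ∘ e) (g ∘ e) :=
  fun a b => h (e a) (e b)

/-- Permutations with the same relative order coincide. -/
theorem SameOrder.eq_of_perm {k : ℕ} {σ τ : Equiv.Perm (Fin k)} (h : SameOrder σ τ) : σ = τ := by
  have hm : StrictMono (σ * τ⁻¹ : Equiv.Perm (Fin k)) := by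
    intro a b hab
    have := (h (τ⁻¹ a) (τ⁻¹ b)).2 (by simpa using hab)
    simpa using this
  have h1 : (⇑(σ * τ⁻¹ : Equiv.Perm (Fin k))) = id := by
    have := Subsingleton.elim
      (hm.orderIsoOfSurjective _ (σ * τ⁻¹ : Equiv.Perm (Fin k)).surjective)
      (OrderIso.refl (Fin k))
    funext a
    exact congrArg (fun e : Fin k ≃o Fin k => e a) this
  have h2 : σ * τ⁻¹ = 1 := by ext a; simp [h1]
  exact mul_inv_eq_one.mp h2

/-- The standardization of a word: the permutation in the same relative order. -/
def std {α : Type*} [LinearOrder α] {k : ℕ} (f : Fin k → α) : Equiv.Perm (Fin k) :=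
  (Tuple.sort f)⁻¹

theorem sameOrder_std {α : Type*} [LinearOrder α] {k : ℕ} {f : Fin k → α}
    (hf : Function.Injective f) : SameOrder f (std f) := by
  have hm : StrictMono (f ∘ Tuple.sort f) :=
    (Tuple.monotone_sort f).strictMono_of_injective (hf.comp (Tuple.sort f).injective)
  intro a b
  have := hm.lt_iff_lt (a := (Tuple.sort f)⁻¹ a) (b := (Tuple.sort f)⁻¹ b)
  simpa [std] using this

theorem std_eq_iff {α : Type*} [LinearOrder α] {k : ℕ} {f : Fin k → α}
    (hf : Function.Injective f) {τ : Equiv.Perm (Fin k)} : std f = τ ↔ SameOrder f τ :=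
  ⟨fun h => h ▸ sameOrder_std hf, fun h => ((sameOrder_std hf).symm.trans h).eq_of_perm⟩

theorem std_comp {α : Type*} [LinearOrder α] {k : ℕ} {f : Fin k → α}
    (hf : Function.Injective f) (h : Equiv.Perm (Fin k)) : std (f ∘ h) = std f * h :=
  (std_eq_iff (hf.comp h.injective)).2 ((sameOrder_std hf).comp h)

/-- The `l` consecutive entries of `π` starting at position `i`. -/
def window {n : ℕ} (π : Equiv.Perm (Fin n)) (i l : ℕ) (h : i + l ≤ n) : Fin l → Fin n :=
  fun j => π ⟨i + j, by omega⟩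

theorem window_injective {n : ℕ} (π : Equiv.Perm (Fin n)) (i l : ℕ) (h : i + l ≤ n) :
    Function.Injective (window π i l h) := by
  intro a b hab
  have := congrArg Fin.val (π.injective hab)
  simp only [Nat.add_left_cancel_iff] at this
  exact Fin.ext this

theorem occursAt_iff_std {m n : ℕ} {σ : Equiv.Perm (Fin m)} {π : Equiv.Perm (Fin n)} {i : ℕ}
    (h : i + m ≤ n) : OccursAt σ π i ↔ std (window π i m h) = σ := by
  rw [std_eq_iff (window_injective π i m h)]
  exact ⟨fun ⟨_, h'⟩ => h', fun h' => ⟨h, h'⟩⟩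

theorem occursAt_std_window {m n : ℕ} {σ : Equiv.Perm (Fin m)} {π : Equiv.Perm (Fin n)}
    {i j l : ℕ} (h : i + l ≤ n) (hj : j + m ≤ l) :
    OccursAt σ (std (window π i l h)) j ↔ OccursAt σ π (i + j) := by
  have key : SameOrder (fun a : Fin m => π ⟨i + j + a, by omega⟩)
      (fun a : Fin m => std (window π i l h) ⟨j + a, by omega⟩) := by
    intro a b
    have := sameOrder_std (window_injective π i l h) ⟨j + a, by omega⟩ ⟨j + b, by omega⟩
    simpa only [window, add_assoc] using this
  constructor
  · rintro ⟨_, h'⟩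
    exact ⟨by omega, key.trans h'⟩
  · rintro ⟨_, h'⟩
    exact ⟨hj, key.symm.trans h'⟩

end Standardization

/-! ### Uniform probability on S_n and independence of disjoint blocks -/

section Probability

/-- The proportion of the permutations in `S_n` that belong to `A`. -/
noncomputable def prob {n : ℕ} (A : Set (Equiv.Perm (Fin n))) : ℝ := (Nat.card A : ℝ) / (n ! : ℝ)

theorem prob_nonneg {n : ℕ} (A : Set (Equiv.Perm (Fin n))) : 0 ≤ prob A := by
  unfold prob; positivity

theorem prob_mono {n : ℕ} {A B : Set (Equiv.Perm (Fin n))} (h : A ⊆ B) : prob A ≤ prob B := by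
  unfold prob
  gcongr
  exact Nat.card_mono (Set.toFinite B) h

theorem prob_union_le {n : ℕ} (A B : Set (Equiv.Perm (Fin n))) :
    prob (A ∪ B) ≤ prob A + prob B := by
  unfold prob
  rw [← add_div]
  gcongr
  exact_mod_cast Set.ncard_union_le A B

theorem prob_union_of_disjoint {n : ℕ} {A B : Set (Equiv.Perm (Fin n))} (h : Disjoint A B) :
    prob (A ∪ B) = prob A + prob B := by
  unfold prob
  rw [← add_div]
  congr 1
  exact_mod_cast Set.ncard_union_eq h (Set.toFinite A) (Set.toFinite B)

theorem prob_univ {n : ℕ} : prob (Set.univ : Set (Equiv.Perm (Fin n))) = 1 := by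
  unfold prob
  rw [Nat.card_univ, Nat.card_eq_fintype_card, Fintype.card_perm, Fintype.card_fin]
  exact div_self (by positivity)

theorem prob_singleton {n : ℕ} (τ : Equiv.Perm (Fin n)) : prob {τ} = 1 / (n ! : ℝ) := by
  simp [prob]

/-- The pair of standardizations of the first `k` and the last `l` entries. -/
def splitStd {k l : ℕ} (π : Equiv.Perm (Fin (k + l))) :
    Equiv.Perm (Fin k) × Equiv.Perm (Fin l) :=
  (std (window π 0 k (by omega)), std (window π k l le_rfl))

/-- Permute the first `k` and the last `l` positions separately. -/
def blockPerm {k l : ℕ} (h : Equiv.Perm (Fin k) × Equiv.Perm (Fin l)) :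
    Equiv.Perm (Fin (k + l)) :=
  finSumFinEquiv.permCongr (Equiv.Perm.sumCongr h.1 h.2)

theorem blockPerm_inv {k l : ℕ} (h : Equiv.Perm (Fin k) × Equiv.Perm (Fin l)) :
    blockPerm h⁻¹ = (blockPerm h)⁻¹ := by
  ext x
  simp [blockPerm, Equiv.permCongr_def]

/-- This equivariance makes all fibres of `splitStd` equally large, which is the source of
independence. -/
theorem splitStd_mul {k l : ℕ} (π : Equiv.Perm (Fin (k + l)))
    (h : Equiv.Perm (Fin k) × Equiv.Perm (Fin l)) :
    splitStd (π * blockPerm h) = splitStd π * h := by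
  refine Prod.ext ?_ ?_
  · have : window (π * blockPerm h) 0 k (by omega) = window π 0 k (by omega) ∘ h.1 := by
      funext j
      have hj (i : Fin k) : (⟨i, by omega⟩ : Fin (k + l)) = Fin.castAdd l i := rfl
      simp [window, hj, blockPerm, Equiv.permCongr_apply]
    simp only [splitStd, this, Prod.fst_mul]
    exact std_comp (window_injective _ _ _ _) h.1
  · have : window (π * blockPerm h) k l le_rfl = window π k l le_rfl ∘ h.2 := by
      funext j
      have hj : (⟨k + j, by omega⟩ : Fin (k + l)) = Fin.natAdd k j := rfl
      have hj' : (⟨k + h.2 j, by omega⟩ : Fin (k + l)) = Fin.natAdd k (h.2 j) := rfl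
      simp [window, hj, hj', blockPerm, Equiv.permCongr_apply]
    simp only [splitStd, this, Prod.snd_mul]
    exact std_comp (window_injective _ _ _ _) h.2

/-- A permutation is determined by its pair of standardizations and by a permutation that is
increasing on both blocks. -/
def splitEquiv {k l : ℕ} (S : Set (Equiv.Perm (Fin k) × Equiv.Perm (Fin l))) :
    {π : Equiv.Perm (Fin (k + l)) // splitStd π ∈ S} ≃
      S × {π : Equiv.Perm (Fin (k + l)) // splitStd π = 1} where
  toFun π := (⟨splitStd π.1, π.2⟩, ⟨π.1 * blockPerm (splitStd π.1)⁻¹, by simp [splitStd_mul]⟩)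
  invFun x := ⟨x.2.1 * blockPerm x.1.1, by rw [splitStd_mul, x.2.2, one_mul]; exact x.1.2⟩
  left_inv π := by simp [blockPerm_inv]
  right_inv x := by
    obtain ⟨⟨s, hs⟩, ⟨π, hπ⟩⟩ := x
    simp [splitStd_mul, hπ, blockPerm_inv]

/-- The relative orders of the first `k` and of the last `l` entries are independent. -/
theorem prob_split {k l n : ℕ} (h : k + l = n) (A : Set (Equiv.Perm (Fin k)))
    (B : Set (Equiv.Perm (Fin l))) :
    prob {π : Equiv.Perm (Fin n) | std (window π 0 k (by omega)) ∈ A ∧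
      std (window π k l h.le) ∈ B} = prob A * prob B := by
  subst h
  -- The common fibre size is never computed: the case of all pairs shows that it is (k+l)!/(k! l!),
  -- and it cancels.
  have h1 := Nat.card_congr (splitEquiv (A ×ˢ B))
  have h2 := Nat.card_congr (splitEquiv (k := k) (l := l) Set.univ)
  rw [Nat.card_prod] at h1 h2
  rw [Nat.card_congr (Equiv.Set.prod A B), Nat.card_prod] at h1
  have h3 : Nat.card {π : Equiv.Perm (Fin (k + l)) // splitStd π ∈ Set.univ} = (k + l)! := by
    simp [Nat.card_eq_fintype_card, Fintype.card_perm]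
  have h4 : Nat.card (Set.univ : Set (Equiv.Perm (Fin k) × Equiv.Perm (Fin l))) = k ! * l ! := by
    simp [Nat.card_eq_fintype_card, Fintype.card_perm]
  rw [h3, h4] at h2
  unfold prob
  have h5 : Nat.card {π : Equiv.Perm (Fin (k + l)) | std (window π 0 k (by omega)) ∈ A ∧
      std (window π k l le_rfl) ∈ B} = _ := h1
  rw [h5, div_mul_div_comm, div_eq_div_iff (by positivity) (by positivity), h2]
  push_cast
  ring

end Probability

/-! ### One-sided cluster recurrences for the avoidance probabilities -/

section Recurrences

/-- The proportion of the permutations in `S_n` that avoid `σ`. -/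
noncomputable def avoidProb {m : ℕ} (σ : Equiv.Perm (Fin m)) (n : ℕ) : ℝ :=
  (alpha σ n : ℝ) / (n ! : ℝ)

theorem avoidProb_eq_prob {m : ℕ} (σ : Equiv.Perm (Fin m)) (n : ℕ) :
    avoidProb σ n = prob {π : Equiv.Perm (Fin n) | Avoids σ π} := rfl

theorem avoidProb_nonneg {m : ℕ} (σ : Equiv.Perm (Fin m)) (n : ℕ) : 0 ≤ avoidProb σ n :=
  prob_nonneg _

/-- The first `k` entries of `π` avoid `σ`. -/
def PrefixAvoids {m n : ℕ} (σ : Equiv.Perm (Fin m)) (π : Equiv.Perm (Fin n)) (k : ℕ) : Prop :=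
  ∀ i : ℕ, i + m ≤ k → ¬ OccursAt σ π i

theorem PrefixAvoids.mono {m n k l : ℕ} {σ : Equiv.Perm (Fin m)} {π : Equiv.Perm (Fin n)}
    (h : PrefixAvoids σ π l) (hkl : k ≤ l) : PrefixAvoids σ π k :=
  fun i hi => h i (hi.trans hkl)

theorem prefixAvoids_self {m n : ℕ} {σ : Equiv.Perm (Fin m)} {π : Equiv.Perm (Fin n)} :
    PrefixAvoids σ π n ↔ Avoids σ π :=
  ⟨fun h i hi => h i hi.1 hi, fun h i _ => h i⟩

theorem prefixAvoids_iff {m n k : ℕ} {σ : Equiv.Perm (Fin m)} {π : Equiv.Perm (Fin n)}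
    (h : 0 + k ≤ n) : PrefixAvoids σ π k ↔ Avoids σ (std (window π 0 k h)) := by
  constructor
  · intro H i hi
    have := (occursAt_std_window h hi.1).1 hi
    rw [zero_add] at this
    exact H i hi.1 this
  · intro H i hi h'
    refine H i ((occursAt_std_window h hi).2 ?_)
    rwa [zero_add]

theorem prob_prefixAvoids_inter {m k l n : ℕ} (σ : Equiv.Perm (Fin m)) (h : k + l = n)
    (B : Set (Equiv.Perm (Fin l))) :
    prob {π : Equiv.Perm (Fin n) | PrefixAvoids σ π k ∧ std (window π k l h.le) ∈ B} =
      avoidProb σ k * prob B := by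
  rw [avoidProb_eq_prob, ← prob_split h]
  congr 1
  ext π
  simp only [Set.mem_ofPred_eq, prefixAvoids_iff (π := π) (k := k) (σ := σ) (by omega)]

theorem prob_prefixAvoids {m k n : ℕ} (σ : Equiv.Perm (Fin m)) (h : k ≤ n) :
    prob {π : Equiv.Perm (Fin n) | PrefixAvoids σ π k} = avoidProb σ k := by
  have := prob_prefixAvoids_inter σ (Nat.add_sub_cancel' h) Set.univ
  rw [prob_univ, mul_one] at this
  simpa using this

theorem prob_prefixAvoids_occursAt {m k l n : ℕ} (σ : Equiv.Perm (Fin m)) (h : k + l = n)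
    (τ : Equiv.Perm (Fin l)) :
    prob {π : Equiv.Perm (Fin n) | PrefixAvoids σ π k ∧ OccursAt τ π k} =
      avoidProb σ k / (l ! : ℝ) := by
  rw [div_eq_mul_one_div, ← prob_singleton τ, ← prob_prefixAvoids_inter σ h]
  simp only [occursAt_iff_std h.le, Set.mem_singleton_iff]

/-- Both blocks of an avoiding permutation avoid σ, and they are independent; occurrences straddling
the cut are ignored. -/
theorem avoidProb_add_le {m : ℕ} (σ : Equiv.Perm (Fin m)) (k l : ℕ) :
    avoidProb σ (k + l) ≤ avoidProb σ k * avoidProb σ l := by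
  rw [avoidProb_eq_prob σ l, ← prob_prefixAvoids_inter σ rfl, avoidProb_eq_prob]
  refine prob_mono fun π hπ => ⟨fun i _ => hπ i, fun i hi => ?_⟩
  exact hπ _ ((occursAt_std_window le_rfl hi.1).1 hi)

theorem avoidProb_of_lt {m n : ℕ} (σ : Equiv.Perm (Fin m)) (h : n < m) : avoidProb σ n = 1 := by
  rw [avoidProb_eq_prob, ← prob_univ (n := n)]
  congr 1
  ext π
  simp only [Set.mem_ofPred_eq, Set.mem_univ, iff_true]
  rintro i ⟨hi, -⟩
  omega

/-- The probability that the first occurrence of `σ` is at the very end. -/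
theorem prob_first_occurrence {m k n : ℕ} (σ : Equiv.Perm (Fin m)) (h : k + m = n) :
    prob {π : Equiv.Perm (Fin n) | PrefixAvoids σ π (n - 1) ∧ OccursAt σ π k} =
      avoidProb σ (n - 1) - avoidProb σ n := by
  rw [eq_sub_iff_add_eq, avoidProb_eq_prob σ n, ← prob_union_of_disjoint,
    ← prob_prefixAvoids σ (Nat.sub_le n 1)]
  · congr 1
    ext π
    simp only [Set.mem_union, Set.mem_ofPred_eq, ← prefixAvoids_self (π := π)]
    constructor
    · rintro (⟨h1, -⟩ | h1)
      · exact h1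
      · exact h1.mono (Nat.sub_le n 1)
    · intro h1
      by_cases h2 : OccursAt σ π k
      · exact Or.inl ⟨h1, h2⟩
      · refine Or.inr fun i hi => ?_
        by_cases h3 : i = k
        · rwa [h3]
        · exact h1 i (by omega)
  · rw [Set.disjoint_left]
    rintro π ⟨-, h1⟩ h2
    exact h2 k h1

/-- The probability that a permutation of length `2m - 1` consists of two occurrences of `σ` that
share one entry. -/
noncomputable def clusterProb {m : ℕ} (σ : Equiv.Perm (Fin m)) : ℝ :=
  prob {π : Equiv.Perm (Fin (2 * m - 1)) | OccursAt σ π 0 ∧ OccursAt σ π (m - 1)}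

/-- Two occurrences of `σ` at distance less than `m` yield an overlap of `σ`. -/
theorem mem_overlapSet_of_occursAt {m n i d : ℕ} {σ : Equiv.Perm (Fin m)}
    {π : Equiv.Perm (Fin n)} (h1 : 1 ≤ d) (h2 : d < m) (hi : OccursAt σ π i)
    (hd : OccursAt σ π (i + d)) : d ∈ overlapSet σ := by
  obtain ⟨_, hi⟩ := hi
  obtain ⟨_, hd⟩ := hd
  refine ⟨h1, h2, fun a b => ?_⟩
  have e1 := hi ⟨d + a, by omega⟩ ⟨d + b, by omega⟩
  have e2 := hd ⟨a, by omega⟩ ⟨b, by omega⟩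
  simp only [← add_assoc] at e1 e2
  exact e1.symm.trans e2

/-- Suppose the first k entries avoid σ and σ occurs at k. Either this occurrence is the first one,
or an earlier one meets it. Non-overlapping forces the earlier one to start at k - (m-1), giving a
cluster of length 2m - 1 after an avoiding prefix. -/
theorem avoidProb_recurrence_of_nonOverlapping {m : ℕ} {σ : Equiv.Perm (Fin m)} (hm : 2 ≤ m)
    (hσ : NonOverlapping σ) (k : ℕ) :
    avoidProb σ k / (m ! : ℝ) ≤ avoidProb σ (k + m - 1) - avoidProb σ (k + m) +
      (if m - 1 ≤ k then clusterProb σ * avoidProb σ (k - (m - 1)) else 0) := by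
  rw [← prob_prefixAvoids_occursAt σ (rfl : k + m = k + m) σ,
    ← prob_first_occurrence σ rfl]
  have key : ∀ π : Equiv.Perm (Fin (k + m)), PrefixAvoids σ π k → OccursAt σ π k →
      ¬ PrefixAvoids σ π (k + m - 1) → m - 1 ≤ k ∧ OccursAt σ π (k - (m - 1)) := by
    intro π h1 h2 h3
    simp only [PrefixAvoids, not_forall, not_not] at h3
    obtain ⟨i, hi, h3⟩ := h3
    have hik : k < i + m := by
      by_contra hc
      exact h1 i (by omega) h3
    have hd := mem_overlapSet_of_occursAt (d := k - i) (by omega) (by omega) h3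
      (by rwa [show i + (k - i) = k by omega])
    rw [hσ, Set.mem_singleton_iff] at hd
    refine ⟨by omega, ?_⟩
    rwa [show k - (m - 1) = i by omega]
  split_ifs with hk
  · have h' : k - (m - 1) + (2 * m - 1) = k + m := by omega
    rw [mul_comm, clusterProb, ← prob_prefixAvoids_inter σ h']
    refine le_trans (prob_mono ?_) (prob_union_le _ _)
    rintro π ⟨h1, h2⟩
    by_cases h3 : PrefixAvoids σ π (k + m - 1)
    · exact Or.inl ⟨h3, h2⟩
    · refine Or.inr ⟨h1.mono (by omega), (occursAt_std_window h'.le (by omega)).2 ?_,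
        (occursAt_std_window h'.le (by omega)).2 ?_⟩
      · exact (key π h1 h2 h3).2
      · rwa [show k - (m - 1) + (m - 1) = k by omega]
  · rw [add_zero]
    refine prob_mono ?_
    rintro π ⟨h1, h2⟩
    refine ⟨?_, h2⟩
    by_contra h3
    exact hk (key π h1 h2 h3).1

theorem occursAt_monotonePattern_iff {l n i : ℕ} {π : Equiv.Perm (Fin n)} :
    OccursAt (monotonePattern l) π i ↔
      i + l ≤ n ∧ ∀ a b : Fin n, i ≤ a → a < b → (b : ℕ) < i + l → π a < π b := by
  constructor
  · rintro ⟨h, H⟩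
    refine ⟨h, fun a b ha hab hb => ?_⟩
    have hab' : (a : ℕ) < b := hab
    have := (H ⟨a - i, by omega⟩ ⟨b - i, by omega⟩).2
      (by simp only [monotonePattern, Equiv.refl_apply, Fin.mk_lt_mk]; omega)
    simpa only [show i + (a - i : ℕ) = a by omega, show i + (b - i : ℕ) = b by omega] using this
  · rintro ⟨h, H⟩
    have hmono : StrictMono (fun j : Fin l => π ⟨i + j, by omega⟩) := by
      intro a b hab
      have hab' : (a : ℕ) < b := hab
      exact H _ _ (by simp) (by simpa using hab) (by simp)
    exact ⟨h, fun a b => hmono.lt_iff_lt⟩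

theorem occursAt_monotonePattern_of_le {l l' n i i' : ℕ} {π : Equiv.Perm (Fin n)}
    (h : OccursAt (monotonePattern l) π i) (h1 : i ≤ i') (h2 : i' + l' ≤ i + l) :
    OccursAt (monotonePattern l') π i' := by
  rw [occursAt_monotonePattern_iff] at h ⊢
  exact ⟨by omega, fun a b ha hab hb => h.2 a b (by omega) hab (by omega)⟩

/-- Increasing runs that share an entry merge into one. -/
theorem occursAt_monotonePattern_append {l l' n i i' : ℕ} {π : Equiv.Perm (Fin n)}
    (h : OccursAt (monotonePattern l) π i) (h' : OccursAt (monotonePattern l') π i')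
    (h2 : i' < i + l) :
    OccursAt (monotonePattern (i' + l' - i)) π i := by
  rw [occursAt_monotonePattern_iff] at h h' ⊢
  refine ⟨by omega, fun a b ha hab hb => ?_⟩
  have hab' : (a : ℕ) < b := hab
  by_cases h3 : (b : ℕ) < i + l
  · exact h.2 a b ha hab h3
  by_cases h4 : i' ≤ a
  · exact h'.2 a b h4 hab (by omega)
  · have e1 := h.2 a ⟨i', by omega⟩ ha (by rw [Fin.lt_def]; simp; omega) h2
    have e2 := h'.2 ⟨i', by omega⟩ b le_rfl (by rw [Fin.lt_def]; simp; omega) (by omega)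
    exact e1.trans e2

/-- The two events on the left are disjoint, since a run of length m + 1 from k - 1 contains an
occurrence at k - 1. In the second event the first k entries can contain an occurrence only at k -
m, and that one merges with the run into a run of length 2m; otherwise the first k entries avoid the
pattern. -/
theorem avoidProb_monotonePattern_recurrence {m : ℕ} (hm : 1 ≤ m) (k : ℕ) :
    avoidProb (monotonePattern m) (k + m - 1) - avoidProb (monotonePattern m) (k + m) +
      (if 1 ≤ k then avoidProb (monotonePattern m) (k - 1) / ((m + 1)! : ℝ) else 0) ≤
    avoidProb (monotonePattern m) k / (m ! : ℝ) +
      (if m ≤ k then avoidProb (monotonePattern m) (k - m) / ((2 * m)! : ℝ) else 0) := by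
  set σ := monotonePattern m with hσ
  rw [← prob_first_occurrence σ rfl,
    ← prob_prefixAvoids_occursAt σ (rfl : k + m = k + m) σ]
  split_ifs with h1 h2 h2
  · rw [← prob_prefixAvoids_occursAt σ (show k - 1 + (m + 1) = k + m by omega)
      (monotonePattern (m + 1)), ← prob_prefixAvoids_occursAt σ
      (show k - m + 2 * m = k + m by omega) (monotonePattern (2 * m)),
      ← prob_union_of_disjoint]
    · refine le_trans (prob_mono ?_) (prob_union_le _ _)
      rintro π (⟨ha, hb⟩ | ⟨ha, hb⟩)
      · exact Or.inl ⟨ha.mono (by omega), hb⟩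
      · by_cases h3 : OccursAt σ π (k - m)
        · refine Or.inr ⟨ha.mono (by omega), ?_⟩
          have := occursAt_monotonePattern_append h3 hb (by omega)
          rwa [show k - 1 + (m + 1) - (k - m) = 2 * m by omega] at this
        · refine Or.inl ⟨fun i hi => ?_,
            occursAt_monotonePattern_of_le hb (by omega) (by omega)⟩
          by_cases h4 : i = k - m
          · rwa [h4]
          · exact ha i (by omega)
    · rw [Set.disjoint_left]
      rintro π ⟨ha, -⟩ ⟨-, hb⟩
      exact ha (k - 1) (by omega) (occursAt_monotonePattern_of_le hb le_rfl (by omega))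
  · rw [← prob_prefixAvoids_occursAt σ (show k - 1 + (m + 1) = k + m by omega)
      (monotonePattern (m + 1)), ← prob_union_of_disjoint, add_zero]
    · refine prob_mono ?_
      rintro π (⟨ha, hb⟩ | ⟨ha, hb⟩)
      · exact ⟨ha.mono (by omega), hb⟩
      · exact ⟨fun i hi => by omega, occursAt_monotonePattern_of_le hb (by omega) (by omega)⟩
    · rw [Set.disjoint_left]
      rintro π ⟨ha, -⟩ ⟨-, hb⟩
      exact ha (k - 1) (by omega) (occursAt_monotonePattern_of_le hb le_rfl (by omega))
  · omega
  · rw [add_zero, add_zero]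
    exact prob_mono fun π hπ => ⟨hπ.1.mono (by omega), hπ.2⟩

/-- The first m entries must be ordered like σ and the last m - 1 like the tail of σ; these blocks
are disjoint, hence independent. -/
theorem clusterProb_le {m : ℕ} (hm : 1 ≤ m) (σ : Equiv.Perm (Fin m)) :
    clusterProb σ ≤ 1 / (m ! : ℝ) * (1 / ((m - 1)! : ℝ)) := by
  have h : m + (m - 1) = 2 * m - 1 := by omega
  have htail : Function.Injective (fun j : Fin (m - 1) => σ ⟨1 + j, by omega⟩) := by
    intro a b hab
    have := congrArg Fin.val (σ.injective hab)
    simp only [Nat.add_left_cancel_iff] at this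
    exact Fin.ext this
  rw [← prob_singleton σ,
    ← prob_singleton (std (fun j : Fin (m - 1) => σ ⟨1 + j, by omega⟩)), ← prob_split h]
  refine prob_mono ?_
  rintro π ⟨h1, h2⟩
  refine ⟨(occursAt_iff_std (by omega)).1 h1, ?_⟩
  rw [Set.mem_singleton_iff, std_eq_iff (window_injective _ _ _ _)]
  refine SameOrder.trans ?_ (sameOrder_std htail)
  obtain ⟨h3, h2⟩ := h2
  intro a b
  have := h2 ⟨1 + a, by omega⟩ ⟨1 + b, by omega⟩
  simpa only [window, ← add_assoc, show m - 1 + 1 = m by omega] using this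

end Recurrences

/-! ### Existence of growth constants and convergence of the series -/

section Growth

theorem avoidProb_pos {m : ℕ} (hm : 2 ≤ m) (σ : Equiv.Perm (Fin m)) (n : ℕ) :
    0 < avoidProb σ n := by
  -- The decreasing permutation avoids the increasing pattern, and the identity avoids every other
  -- one.
  obtain ⟨π, hπ⟩ : ∃ π : Equiv.Perm (Fin n), Avoids σ π := by
    by_cases hσ : σ = 1
    · refine ⟨Fin.revPerm, ?_⟩
      rintro i ⟨h, H⟩
      have := (H ⟨0, by omega⟩ ⟨1, by omega⟩).2 (by simp [hσ])
      simp at this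
    · refine ⟨1, ?_⟩
      rintro i ⟨h, H⟩
      refine hσ (SameOrder.eq_of_perm fun a b => ?_)
      rw [← H a b]
      simp
  have : Nonempty {π : Equiv.Perm (Fin n) // Avoids σ π} := ⟨⟨π, hπ⟩⟩
  have h1 : 0 < alpha σ n := Nat.card_pos
  unfold avoidProb
  positivity

/-- Fekete's lemma for submultiplicative sequences in `(0, 1]`. -/
theorem exists_tendsto_rpow_of_submultiplicative {b : ℕ → ℝ} (hpos : ∀ n, 0 < b n)
    (hsub : ∀ k l, b (k + l) ≤ b k * b l) :
    ∃ ρ : ℝ, 0 ≤ ρ ∧ Tendsto (fun n : ℕ => b n ^ ((1 : ℝ) / (n : ℝ))) atTop (𝓝 ρ) ∧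
      ∀ n, 1 ≤ n → ρ ^ n ≤ b n := by
  -- The limit is the infimum of the roots, which also yields the bound ρ ^ n ≤ b n. Index 0 is
  -- excluded because 1/0 = 0 makes `c 0` equal to 1.
  set c : ℕ → ℝ := fun n => b n ^ ((1 : ℝ) / (n : ℝ)) with hc
  have hcpos : ∀ n, 0 < c n := fun n => Real.rpow_pos_of_pos (hpos n) _
  have hbdd : BddBelow (c '' Set.Ici 1) := ⟨0, by rintro _ ⟨n, -, rfl⟩; exact (hcpos n).le⟩
  have hle : ∀ n, 1 ≤ n → sInf (c '' Set.Ici 1) ≤ c n := fun n hn => csInf_le hbdd ⟨n, hn, rfl⟩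
  have h0 : 0 ≤ sInf (c '' Set.Ici 1) :=
    Real.sInf_nonneg (by rintro _ ⟨n, -, rfl⟩; exact (hcpos n).le)
  have hlog : ∀ n, Real.log (c n) = Real.log (b n) / n := by
    intro n
    rw [hc, Real.log_rpow (hpos n)]
    ring
  have hs : Subadditive fun n => Real.log (b n) := fun k l => by
    rw [← Real.log_mul (hpos k).ne' (hpos l).ne']
    exact Real.log_le_log (hpos _) (hsub k l)
  refine ⟨sInf (c '' Set.Ici 1), h0, tendsto_order.2 ⟨fun l hl => ?_, fun L hL => ?_⟩, ?_⟩
  · exact eventually_atTop.2 ⟨1, fun n hn => hl.trans_le (hle n hn)⟩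
  · obtain ⟨_, ⟨n, hn, rfl⟩, hnL⟩ := exists_lt_of_csInf_lt (Set.Nonempty.image c ⟨1, le_refl 1⟩) hL
    have hn' : n ≠ 0 := Nat.one_le_iff_ne_zero.1 hn
    have h1 := Real.log_lt_log (hcpos n) hnL
    rw [hlog] at h1
    filter_upwards [hs.eventually_div_lt_of_div_lt hn' h1] with p hp
    rw [← hlog] at hp
    exact (Real.log_lt_log_iff (hcpos p) ((hcpos n).trans hnL)).1 hp
  · intro n hn
    have hn' : (n : ℝ) ≠ 0 := by positivity
    calc _ ≤ c n ^ n := pow_le_pow_left₀ h0 (hle n hn) n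
      _ = b n := by
        rw [hc, ← Real.rpow_natCast, ← Real.rpow_mul (hpos n).le, one_div_mul_cancel hn',
          Real.rpow_one]

theorem summable_mul_pow_of_tendsto_rpow {b : ℕ → ℝ} {ρ z : ℝ} (hpos : ∀ n, 0 < b n)
    (hb : Tendsto (fun n : ℕ => b n ^ ((1 : ℝ) / (n : ℝ))) atTop (𝓝 ρ)) (hz : 0 < z)
    (hρ : z * ρ < 1) : Summable fun n => b n * z ^ n := by
  have h1 : ρ < 1 / z := by rwa [lt_div_iff₀ hz, mul_comm]
  obtain ⟨r, hr1, hr2⟩ := exists_between h1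
  have hr0 : 0 ≤ r := (ge_of_tendsto' hb fun n => (Real.rpow_pos_of_pos (hpos n) _).le).trans hr1.le
  refine Summable.of_norm_bounded_eventually_nat (g := fun n => (r * z) ^ n)
    (summable_geometric_of_lt_one (by positivity) (by rwa [lt_div_iff₀ hz] at hr2)) ?_
  filter_upwards [hb.eventually (gt_mem_nhds hr1), eventually_ge_atTop 1] with n hn hn1
  have hn' : (n : ℝ) ≠ 0 := by positivity
  rw [Real.norm_of_nonneg (by have := hpos n; positivity), mul_pow]
  gcongr
  calc b n = (b n ^ ((1 : ℝ) / (n : ℝ))) ^ n := by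
        rw [← Real.rpow_natCast, ← Real.rpow_mul (hpos n).le, one_div_mul_cancel hn',
          Real.rpow_one]
    _ ≤ r ^ n := pow_le_pow_left₀ (Real.rpow_pos_of_pos (hpos n) _).le hn.le n

end Growth

/-! ### Generating function inequalities -/

section GeneratingFunctions

theorem hasSum_shift {b : ℕ → ℝ} {z S : ℝ} (h : HasSum (fun n => b n * z ^ n) S) (j : ℕ) :
    HasSum (fun n => (if j ≤ n then b (n - j) else 0) * z ^ n) (z ^ j * S) := by
  rw [← (add_left_injective j).hasSum_iff]
  · rw [show ((fun n => (if j ≤ n then b (n - j) else 0) * z ^ n) ∘ fun n => n + j) =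
      fun n => z ^ j * (b n * z ^ n) from ?_]
    · exact h.mul_left (z ^ j)
    funext n
    simp only [Function.comp_apply, Nat.le_add_left, if_true, Nat.add_sub_cancel, pow_add]
    ring
  · intro n hn
    have : ¬ j ≤ n := fun h => hn ⟨n - j, by simp [h]⟩
    simp [this]

/-- The cluster series of the monotone pattern, truncated after the second cluster. -/
noncomputable def monotonePoly (m : ℕ) (z : ℝ) : ℝ :=
  1 - z + z ^ m / (m ! : ℝ) - z ^ (m + 1) / ((m + 1)! : ℝ) + z ^ (2 * m) / ((2 * m)! : ℝ)

/-- The cluster series of a non-overlapping pattern, truncated after the second cluster. -/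
noncomputable def clusterPoly {m : ℕ} (σ : Equiv.Perm (Fin m)) (z : ℝ) : ℝ :=
  1 - z + z ^ m / (m ! : ℝ) - clusterProb σ * z ^ (2 * m - 1)

/-- The product has constant coefficient 1. For 1 ≤ n < m the coefficient is 0 since both avoidance
probabilities are 1, and for n ≥ m the recurrence makes it nonpositive. -/
theorem clusterPoly_mul_le_one {m : ℕ} {σ : Equiv.Perm (Fin m)} (hm : 2 ≤ m)
    (hσ : NonOverlapping σ) {z S : ℝ} (hz : 0 ≤ z)
    (h : HasSum (fun n => avoidProb σ n * z ^ n) S) : clusterPoly σ z * S ≤ 1 := by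
  have h1 : HasSum _ (S - z ^ 1 * S + z ^ m * S / (m ! : ℝ) -
      clusterProb σ * (z ^ (2 * m - 1) * S)) :=
    ((h.sub (hasSum_shift h 1)).add ((hasSum_shift h m).div_const _)).sub
      ((hasSum_shift h (2 * m - 1)).mul_left (clusterProb σ))
  have h2 : HasSum (fun n : ℕ => if n = 0 then (1 : ℝ) else 0) 1 := hasSum_ite_eq 0 1
  have h3 := hasSum_le (fun n => ?_) h1 h2
  · calc _ = _ := by unfold clusterPoly; ring
      _ ≤ _ := h3
  rcases Nat.eq_zero_or_pos n with rfl | hn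
  · have e1 : ¬ (m ≤ 0) := by omega
    have e2 : ¬ (2 * m - 1 ≤ 0) := by omega
    simp [e1, e2, avoidProb_of_lt σ (show 0 < m by omega)]
  · rw [if_neg hn.ne', if_pos (show 1 ≤ n from hn)]
    have key : avoidProb σ n - avoidProb σ (n - 1) +
        (if m ≤ n then avoidProb σ (n - m) else 0) / (m ! : ℝ) -
        clusterProb σ * (if 2 * m - 1 ≤ n then avoidProb σ (n - (2 * m - 1)) else 0) ≤ 0 := by
      by_cases hmn : m ≤ n
      · obtain ⟨k, rfl⟩ := Nat.exists_eq_add_of_le' hmn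
        have := avoidProb_recurrence_of_nonOverlapping hm hσ k
        rw [if_pos hmn, Nat.add_sub_cancel]
        by_cases hk : m - 1 ≤ k
        · rw [if_pos hk] at this
          rw [if_pos (show 2 * m - 1 ≤ k + m by omega),
            show k + m - (2 * m - 1) = k - (m - 1) by omega]
          linarith
        · rw [if_neg hk] at this
          rw [if_neg (show ¬ (2 * m - 1 ≤ k + m) by omega)]
          linarith
      · rw [if_neg hmn, if_neg (show ¬ (2 * m - 1 ≤ n) by omega), avoidProb_of_lt σ (by omega),
          avoidProb_of_lt σ (by omega)]
        simp
    calc _ = (avoidProb σ n - avoidProb σ (n - 1) +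
        (if m ≤ n then avoidProb σ (n - m) else 0) / (m ! : ℝ) -
        clusterProb σ * (if 2 * m - 1 ≤ n then avoidProb σ (n - (2 * m - 1)) else 0)) * z ^ n := by
          ring
      _ ≤ 0 := mul_nonpos_of_nonpos_of_nonneg key (by positivity)

theorem one_le_monotonePoly_mul {m : ℕ} (hm : 1 ≤ m) {z S : ℝ} (hz : 0 ≤ z)
    (h : HasSum (fun n => avoidProb (monotonePattern m) n * z ^ n) S) :
    1 ≤ monotonePoly m z * S := by
  set σ := monotonePattern m with hσ
  have h1 : HasSum _ (S - z ^ 1 * S + z ^ m * S / (m ! : ℝ) - z ^ (m + 1) * S / ((m + 1)! : ℝ) +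
      z ^ (2 * m) * S / ((2 * m)! : ℝ)) :=
    (((h.sub (hasSum_shift h 1)).add ((hasSum_shift h m).div_const _)).sub
      ((hasSum_shift h (m + 1)).div_const _)).add ((hasSum_shift h (2 * m)).div_const _)
  have h2 : HasSum (fun n : ℕ => if n = 0 then (1 : ℝ) else 0) 1 := hasSum_ite_eq 0 1
  have h3 := hasSum_le (fun n => ?_) h2 h1
  · calc _ ≤ _ := h3
      _ = _ := by unfold monotonePoly; ring
  rcases Nat.eq_zero_or_pos n with rfl | hn
  · have e1 : ¬ (m ≤ 0) := by omega
    have e2 : m ≠ 0 := by omega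
    simp [e2, avoidProb_of_lt σ (show 0 < m by omega)]
  · rw [if_neg hn.ne', if_pos (show 1 ≤ n from hn)]
    have key : 0 ≤ avoidProb σ n - avoidProb σ (n - 1) +
        (if m ≤ n then avoidProb σ (n - m) else 0) / (m ! : ℝ) -
        (if m + 1 ≤ n then avoidProb σ (n - (m + 1)) else 0) / ((m + 1)! : ℝ) +
        (if 2 * m ≤ n then avoidProb σ (n - 2 * m) else 0) / ((2 * m)! : ℝ) := by
      by_cases hmn : m ≤ n
      · obtain ⟨k, rfl⟩ := Nat.exists_eq_add_of_le' hmn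
        have := avoidProb_monotonePattern_recurrence hm k
        rw [← hσ] at this
        rw [if_pos hmn, Nat.add_sub_cancel]
        simp only [show m + 1 ≤ k + m ↔ 1 ≤ k by omega, show 2 * m ≤ k + m ↔ m ≤ k by omega,
          show k + m - (m + 1) = k - 1 by omega, show k + m - 2 * m = k - m by omega]
        simp only [ite_div, zero_div]
        linarith
      · rw [if_neg hmn, if_neg (show ¬ (m + 1 ≤ n) by omega),
          if_neg (show ¬ (2 * m ≤ n) by omega), avoidProb_of_lt σ (by omega),
          avoidProb_of_lt σ (by omega)]
        simp
    calc _ ≤ _ := mul_nonneg key (pow_nonneg hz n)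
      _ = _ := by ring

end GeneratingFunctions

/-! ### Comparison of the two polynomials and of the growth constants -/

section Comparison

/-- For m = 3 the general bound 1/12 from `clusterProb_le` is too weak; a finite check finds at most
3 clusters among the 120 permutations. -/
theorem clusterProb_three_le {σ : Equiv.Perm (Fin 3)} (hσ : NonOverlapping σ) :
    clusterProb σ ≤ 1 / 40 := by
  have h1 : ¬ SameOrder (fun j : Fin 2 => σ ⟨1 + j, by omega⟩)
      (fun j : Fin 2 => σ ⟨j, by omega⟩) := by
    intro h
    have : 1 ∈ overlapSet σ := ⟨le_rfl, by omega, h⟩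
    rw [hσ] at this
    simp at this
  have h2 : ∀ σ : Equiv.Perm (Fin 3),
      (¬ ∀ a b : Fin 2, σ ⟨1 + a, by omega⟩ < σ ⟨1 + b, by omega⟩ ↔
        σ ⟨a, by omega⟩ < σ ⟨b, by omega⟩) →
      (Finset.univ.filter (fun π : Equiv.Perm (Fin 5) =>
        (∀ a b : Fin 3, π ⟨0 + a, by omega⟩ < π ⟨0 + b, by omega⟩ ↔ σ a < σ b) ∧
        (∀ a b : Fin 3, π ⟨2 + a, by omega⟩ < π ⟨2 + b, by omega⟩ ↔ σ a < σ b))).card ≤ 3 := by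
    decide +kernel
  have h3 := h2 σ h1
  have h4 : Nat.card {π : Equiv.Perm (Fin (2 * 3 - 1)) | OccursAt σ π 0 ∧ OccursAt σ π (3 - 1)} ≤
      3 := by
    refine le_trans (le_of_eq ?_) h3
    classical
    rw [Nat.card_eq_card_toFinset]
    congr 1
    ext π
    simp only [Set.mem_toFinset, Set.mem_ofPred_eq, Finset.mem_filter, Finset.mem_univ, true_and]
    exact and_congr ⟨fun ⟨_, h⟩ => h, fun h => ⟨by omega, h⟩⟩
      ⟨fun ⟨_, h⟩ => h, fun h => ⟨by omega, h⟩⟩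
  unfold clusterProb prob
  have h5 : ((2 * 3 - 1)! : ℝ) = 120 := by norm_num [Nat.factorial]
  rw [h5, div_le_div_iff₀ (by norm_num) (by norm_num)]
  have : (Nat.card {π : Equiv.Perm (Fin (2 * 3 - 1)) | OccursAt σ π 0 ∧ OccursAt σ π (3 - 1)} : ℝ)
    ≤ 3 := by exact_mod_cast h4
  linarith

/-- For `m ≥ 5` the terms `(21/20) ^ m / m !` are small. -/
theorem pow_div_factorial_le {m : ℕ} (hm : 5 ≤ m) :
    (21 / 20 : ℝ) ^ m / (m ! : ℝ) ≤ 1 / 20 := by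
  rw [div_le_iff₀ (by positivity)]
  induction m, hm using Nat.le_induction with
  | base => norm_num [Nat.factorial]
  | succ n hn ih =>
    rw [pow_succ, Nat.factorial_succ]
    push_cast
    have : (5 : ℝ) ≤ n := by exact_mod_cast hn
    have h2 : (0 : ℝ) < n ! := by positivity
    nlinarith

/-- The constant 37/40 barely covers m = 4, and with the 1/20 of `pow_mul_factorial_le` it still
stays below 1. -/
theorem pow_mul_succ_le {m : ℕ} (hm : 4 ≤ m) :
    (21 / 20 : ℝ) ^ (m - 2) * (m + 1) ≤ 37 / 40 * ((m - 1)! : ℝ) := by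
  induction m, hm using Nat.le_induction with
  | base => norm_num [Nat.factorial]
  | succ n hn ih =>
    obtain ⟨k, rfl⟩ := Nat.exists_eq_add_of_le' (show 2 ≤ n by omega)
    have hk : (2 : ℝ) ≤ k := by exact_mod_cast (show 2 ≤ k by omega)
    simp only [show k + 2 - 2 = k by omega, show k + 2 - 1 = k + 1 by omega,
      show k + 2 + 1 - 2 = k + 1 by omega, show k + 2 + 1 - 1 = k + 2 by omega] at ih ⊢
    rw [pow_succ, Nat.factorial_succ (k + 1)]
    push_cast at ih ⊢
    have h1 : (0 : ℝ) < (21 / 20 : ℝ) ^ k := by positivity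
    have h2 : (21 / 20 : ℝ) ^ k * (21 / 20) * (k + 2 + 1 + 1) ≤
        (k + 1 + 1) * ((21 / 20 : ℝ) ^ k * (k + 2 + 1)) := by
      have h3 : (21 / 20 : ℝ) * (k + 2 + 1 + 1) ≤ (k + 1 + 1) * (k + 2 + 1) := by nlinarith
      have := mul_le_mul_of_nonneg_left h3 h1.le
      linarith
    have h4 := mul_le_mul_of_nonneg_left ih (show (0 : ℝ) ≤ k + 1 + 1 by positivity)
    linarith

theorem pow_mul_factorial_le {m : ℕ} (hm : 4 ≤ m) :
    (21 / 20 : ℝ) ^ (m - 1) * ((m + 1)! : ℝ) ≤ 1 / 20 * ((2 * m)! : ℝ) := by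
  induction m, hm using Nat.le_induction with
  | base => norm_num [Nat.factorial]
  | succ n hn ih =>
    obtain ⟨k, rfl⟩ := Nat.exists_eq_add_of_le' (show 1 ≤ n by omega)
    have hk : (3 : ℝ) ≤ k := by exact_mod_cast (show 3 ≤ k by omega)
    simp only [Nat.add_sub_cancel] at ih ⊢
    rw [pow_succ, Nat.factorial_succ (k + 1 + 1),
      show 2 * (k + 1 + 1) = 2 * (k + 1) + 1 + 1 by ring, Nat.factorial_succ (2 * (k + 1) + 1),
      Nat.factorial_succ (2 * (k + 1))]
    push_cast
    have h1 : (0 : ℝ) < (21 / 20 : ℝ) ^ k * ((k + 1 + 1)! : ℝ) := by positivity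
    have h2 : (21 / 20 : ℝ) * (k + 1 + 1 + 1) ≤
        (2 * (k + 1) + 1 + 1) * (2 * (k + 1) + 1) := by nlinarith
    calc (21 / 20 : ℝ) ^ k * (21 / 20) * ((k + 1 + 1 + 1) * ((k + 1 + 1)! : ℝ))
        = (21 / 20 * (k + 1 + 1 + 1)) * ((21 / 20 : ℝ) ^ k * ((k + 1 + 1)! : ℝ)) := by ring
      _ ≤ ((2 * (k + 1) + 1 + 1) * (2 * (k + 1) + 1)) * (1 / 20 * ((2 * (k + 1))! : ℝ)) := by
        gcongr
      _ = _ := by ring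

theorem exists_comparison_point {m : ℕ} (hm : 3 ≤ m) {σ : Equiv.Perm (Fin m)}
    (hσ : NonOverlapping σ) :
    ∃ c : ℝ, 0 < c ∧ monotonePoly m c ≤ 0 ∧
      c ^ (m - 1) / ((2 * m)! : ℝ) + clusterProb σ * c ^ (m - 2) < 1 / ((m + 1)! : ℝ) := by
  rcases hm.eq_or_lt with rfl | hm4
  -- At 21/20 the polynomial is still positive for m = 3, so a larger point is needed.
  · refine ⟨5 / 4, by norm_num, by norm_num [monotonePoly, Nat.factorial], ?_⟩
    have := clusterProb_three_le hσ
    norm_num [Nat.factorial]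
    linarith
  replace hm4 : 4 ≤ m := hm4
  have h1 : (21 / 20 : ℝ) ^ (m - 1) / ((2 * m)! : ℝ) ≤ 1 / 20 / ((m + 1)! : ℝ) := by
    rw [div_le_div_iff₀ (by positivity) (by positivity)]
    exact pow_mul_factorial_le hm4
  have h2 : clusterProb σ * (21 / 20 : ℝ) ^ (m - 2) ≤ 37 / 40 / ((m + 1)! : ℝ) := by
    calc _ ≤ 1 / (m ! : ℝ) * (1 / ((m - 1)! : ℝ)) * (21 / 20 : ℝ) ^ (m - 2) := by
          gcongr
          exact clusterProb_le (by omega) σ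
      _ ≤ _ := by
          rw [le_div_iff₀ (by positivity), Nat.factorial_succ m]
          push_cast
          have h3 : (0 : ℝ) < ((m - 1)! : ℝ) := by positivity
          have h4 : (0 : ℝ) < (m ! : ℝ) := by positivity
          calc _ = ((21 / 20 : ℝ) ^ (m - 2) * (m + 1)) / ((m - 1)! : ℝ) := by field_simp
            _ ≤ _ := by rw [div_le_iff₀ h3]; exact pow_mul_succ_le hm4
  have h0 : (0 : ℝ) < 1 / ((m + 1)! : ℝ) := by positivity
  refine ⟨21 / 20, by norm_num, ?_, ?_⟩
  · rcases hm4.eq_or_lt with rfl | hm5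
    · norm_num [monotonePoly, Nat.factorial]
    · have h3 := pow_div_factorial_le (m := m) hm5
      -- The last two terms of the polynomial are together nonpositive, and 1 - 21/20 = -1/20
      -- absorbs the z^m/m! term.
      have h4 : (21 / 20 : ℝ) ^ (2 * m) / ((2 * m)! : ℝ) ≤
          (21 / 20 : ℝ) ^ (m + 1) / ((m + 1)! : ℝ) := by
        rw [show 2 * m = (m + 1) + (m - 1) by omega, pow_add, mul_div_assoc,
          show (m + 1) + (m - 1) = 2 * m by omega, div_eq_mul_one_div _ ((m + 1)! : ℝ)]
        refine mul_le_mul_of_nonneg_left (h1.trans ?_) (by positivity)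
        gcongr
        norm_num
      unfold monotonePoly
      linarith
  · have e1 : 1 / 20 / ((m + 1)! : ℝ) = 1 / 20 * (1 / ((m + 1)! : ℝ)) := by ring
    have e2 : 37 / 40 / ((m + 1)! : ℝ) = 37 / 40 * (1 / ((m + 1)! : ℝ)) := by ring
    rw [e1] at h1
    rw [e2] at h2
    linarith

/-- The difference is z^(m+1) times a factor that does not increase with z, so positivity of that
factor at c suffices. -/
theorem monotonePoly_lt_clusterPoly {m : ℕ} (hm : 2 ≤ m) {σ : Equiv.Perm (Fin m)} {c z : ℝ}
    (hc : c ^ (m - 1) / ((2 * m)! : ℝ) + clusterProb σ * c ^ (m - 2) < 1 / ((m + 1)! : ℝ))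
    (hz : 0 < z) (hzc : z ≤ c) : monotonePoly m z < clusterPoly σ z := by
  have hp : 0 ≤ clusterProb σ := prob_nonneg _
  have h1 : z ^ (m - 1) / ((2 * m)! : ℝ) + clusterProb σ * z ^ (m - 2) < 1 / ((m + 1)! : ℝ) := by
    refine lt_of_le_of_lt ?_ hc
    gcongr
  have h2 : clusterPoly σ z - monotonePoly m z = z ^ (m + 1) * (1 / ((m + 1)! : ℝ) -
      (z ^ (m - 1) / ((2 * m)! : ℝ) + clusterProb σ * z ^ (m - 2))) := by
    have e1 : z ^ (2 * m) = z ^ (m + 1) * z ^ (m - 1) := by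
      rw [← pow_add]; congr 1; omega
    have e2 : z ^ (2 * m - 1) = z ^ (m + 1) * z ^ (m - 2) := by
      rw [← pow_add]; congr 1; omega
    rw [clusterPoly, monotonePoly, e1, e2]
    ring
  have h3 : 0 < clusterPoly σ z - monotonePoly m z := by
    rw [h2]
    exact mul_pos (by positivity) (sub_pos.2 h1)
  linarith

/-- A continuous function on `[0, c]` with `f 0 > 0 ≥ f c` has a first zero. -/
theorem exists_first_zero {f : ℝ → ℝ} {c : ℝ} (hf : Continuous f) (hc : 0 < c) (h0 : 0 < f 0)
    (hfc : f c ≤ 0) : ∃ z, 0 < z ∧ z ≤ c ∧ f z ≤ 0 ∧ ∀ x, 0 ≤ x → x ≤ z → 0 ≤ f x := by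
  have hK : IsCompact (Set.Icc 0 c ∩ f ⁻¹' Set.Iic 0) :=
    isCompact_Icc.inter_right (isClosed_Iic.preimage hf)
  obtain ⟨z, ⟨⟨hz0, hzc⟩, hfz⟩, hmin⟩ := hK.exists_isLeast ⟨c, ⟨hc.le, le_rfl⟩, hfc⟩
  have hlt : ∀ x, 0 ≤ x → x < z → 0 < f x := by
    intro x hx hxz
    by_contra hcon
    exact absurd (hmin ⟨⟨hx, hxz.le.trans hzc⟩, not_lt.1 hcon⟩) (not_le.2 hxz)
  have hz : 0 < z := by
    rcases hz0.eq_or_lt with h | h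
    · rw [← h] at hfz
      exact absurd hfz (not_le.2 h0)
    · exact h
  refine ⟨z, hz, hzc, hfz, fun x hx hxz => ?_⟩
  rcases hxz.eq_or_lt with rfl | h
  · have h1 : x ∈ closure (Set.Ico 0 x) := by
      rw [closure_Ico hz.ne]
      exact ⟨hx, le_rfl⟩
    have h2 : Set.Ico 0 x ⊆ f ⁻¹' Set.Ici 0 := fun y hy => (hlt y hy.1 hy.2).le
    exact closure_minimal h2 (isClosed_Ici.preimage hf) h1
  · exact (hlt x hx h).le

theorem monotonePoly_continuous (m : ℕ) : Continuous (monotonePoly m) := by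
  unfold monotonePoly; fun_prop

theorem clusterPoly_continuous {m : ℕ} (σ : Equiv.Perm (Fin m)) : Continuous (clusterPoly σ) := by
  unfold clusterPoly; fun_prop

theorem monotonePoly_zero {m : ℕ} (hm : 1 ≤ m) : monotonePoly m 0 = 1 := by
  simp [monotonePoly, show m ≠ 0 by omega]

theorem clusterPoly_zero {m : ℕ} (hm : 1 ≤ m) (σ : Equiv.Perm (Fin m)) : clusterPoly σ 0 = 1 := by
  simp [clusterPoly, show m ≠ 0 by omega, show 2 * m - 1 ≠ 0 by omega]

/-- If z * ρ < 1 the series would converge at z to a nonnegative sum, and its product with a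
nonpositive value could not reach 1. -/
theorem one_le_mul_growth_monotonePattern {m : ℕ} (hm : 2 ≤ m) {z ρ : ℝ} (hz : 0 < z)
    (hq : monotonePoly m z ≤ 0)
    (hρ : Tendsto (fun n : ℕ => avoidProb (monotonePattern m) n ^ ((1 : ℝ) / (n : ℝ)))
      atTop (𝓝 ρ)) : 1 ≤ z * ρ := by
  by_contra! hlt
  have hs := (summable_mul_pow_of_tendsto_rpow (avoidProb_pos hm _) hρ hz hlt).hasSum
  have h1 := one_le_monotonePoly_mul (by omega) hz.le hs
  have h2 := hs.nonneg fun n => mul_nonneg (avoidProb_nonneg _ n) (pow_nonneg hz.le n)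
  have := mul_nonpos_of_nonpos_of_nonneg hq h2
  linarith

theorem mul_growth_lt_one {m : ℕ} (hm : 2 ≤ m) {σ : Equiv.Perm (Fin m)} (hσ : NonOverlapping σ)
    {z ρ : ℝ} (hz : 0 < z) (ht : ∀ x, 0 ≤ x → x ≤ z → 0 < clusterPoly σ x) (hρ0 : 0 ≤ ρ)
    (hρ : Tendsto (fun n : ℕ => avoidProb σ n ^ ((1 : ℝ) / (n : ℝ))) atTop (𝓝 ρ))
    (hle : ∀ n, 1 ≤ n → ρ ^ n ≤ avoidProb σ n) : z * ρ < 1 := by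
  by_contra! hlt
  have hρpos : 0 < ρ := by
    rcases hρ0.eq_or_lt with rfl | h
    · norm_num at hlt
    · exact h
  obtain ⟨x₀, hx₀, hmin⟩ := isCompact_Icc.exists_isMinOn (Set.nonempty_Icc.2 hz.le)
    (clusterPoly_continuous σ).continuousOn
  set δ := clusterPoly σ x₀ with hδ
  have hδpos : 0 < δ := ht x₀ hx₀.1 hx₀.2
  have hδ1 : δ ≤ 1 := by
    rw [← clusterPoly_zero (by omega) σ]
    exact hmin ⟨le_rfl, hz.le⟩
  -- Here x ≤ z and x * ρ = 1 - δ/2, so comparison with a geometric series gives S ≥ 2/δ, whereas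
  -- the polynomial, at least δ at x, forces S ≤ 1/δ.
  set x := (1 - δ / 2) / ρ with hx
  have hxρ : x * ρ = 1 - δ / 2 := div_mul_cancel₀ _ hρpos.ne'
  have hxpos : 0 < x := div_pos (by linarith) hρpos
  have hxz : x ≤ z := by
    rw [hx, div_le_iff₀ hρpos]
    linarith
  have hs := (summable_mul_pow_of_tendsto_rpow (avoidProb_pos hm _) hρ hxpos (by linarith)).hasSum
  set S := ∑' n, avoidProb σ n * x ^ n with hS
  have h1 := clusterPoly_mul_le_one hm hσ hxpos.le hs
  have hg := hasSum_geometric_of_lt_one (r := x * ρ) (by positivity) (by linarith)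
  have h2 : (1 - x * ρ)⁻¹ ≤ S := by
    refine hasSum_le (fun n => ?_) hg hs
    rw [mul_pow, mul_comm]
    rcases Nat.eq_zero_or_pos n with rfl | hn
    · simp [avoidProb_of_lt σ (show 0 < m by omega)]
    · exact mul_le_mul_of_nonneg_right (hle n hn) (by positivity)
  have h3 : δ ≤ clusterPoly σ x := hmin ⟨hxpos.le, hxz⟩
  have h4 : (1 - x * ρ)⁻¹ = 2 / δ := by rw [hxρ, sub_sub_cancel, inv_div]
  rw [h4] at h2
  have h5 : δ * (2 / δ) ≤ clusterPoly σ x * S := by gcongr; exact hδpos.le.trans h3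
  rw [mul_div_cancel₀ _ hδpos.ne'] at h5
  linarith

end Comparison
end ConsecutivePattern

theorem mainTheorem1 (m : ℕ) (hm : 3 ≤ m) (σ : Equiv.Perm (Fin m))
    (hσ : ConsecutivePattern.NonOverlapping σ) :
    (∃ n₀ : ℕ, ∀ n : ℕ, n₀ ≤ n →
      ConsecutivePattern.alpha σ n <
        ConsecutivePattern.alpha (ConsecutivePattern.monotonePattern m) n) ∧
    (∃ ρσ ρmon : ℝ,
      ConsecutivePattern.IsGrowthConstant σ ρσ ∧
      ConsecutivePattern.IsGrowthConstant (ConsecutivePattern.monotonePattern m) ρmon ∧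
      ρσ < ρmon) := by
  open ConsecutivePattern in
  have hm2 : 2 ≤ m := by omega
  obtain ⟨ρ, hρ0, hρ, hle⟩ := exists_tendsto_rpow_of_submultiplicative
    (avoidProb_pos hm2 σ) (avoidProb_add_le σ)
  obtain ⟨ρ', -, hρ', -⟩ := exists_tendsto_rpow_of_submultiplicative
    (avoidProb_pos hm2 (monotonePattern m)) (avoidProb_add_le (monotonePattern m))
  obtain ⟨c, hc, hqc, hcmp⟩ := exists_comparison_point hm hσ
  obtain ⟨z, hz, hzc, hqz, hq⟩ := exists_first_zero (monotonePoly_continuous m) hc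
    (by rw [monotonePoly_zero (by omega)]; exact one_pos) hqc
  have h1 : z * ρ < 1 := by
    refine mul_growth_lt_one hm2 hσ hz (fun x hx hxz => ?_) hρ0 hρ hle
    rcases hx.eq_or_lt with rfl | hx'
    · rw [clusterPoly_zero (by omega)]
      exact one_pos
    · exact (hq x hx hxz).trans_lt (monotonePoly_lt_clusterPoly hm2 hcmp hx' (hxz.trans hzc))
  have h2 : 1 ≤ z * ρ' := one_le_mul_growth_monotonePattern hm2 hz hqz hρ'
  have hlt : ρ < ρ' := lt_of_mul_lt_mul_left (h1.trans_le h2) hz.le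
  refine ⟨?_, ρ, ρ', hρ, hρ', hlt⟩
  refine eventually_atTop.1 ?_
  filter_upwards [hρ.eventually_lt hρ' hlt] with n hn
  by_contra! hcon
  refine absurd hn (not_lt.2 ?_)
  refine Real.rpow_le_rpow (avoidProb_nonneg _ n) ?_ (by positivity)
  unfold avoidProb
  gcongr
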